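/- Let $p \in [1, \infty)$, let $G$ be a countable discrete amenable group, let $A$ be a unital Banach algebra over $\mathbb{C}$ which is nondegenerately $\sigma$-finitely representable on an $L^p$ space, that is, for some $\sigma$-finite measure space $(X, \mu)$ there is an isometric homomorphism $\pi \colon A \to L(L^p(X,\mu))$ such that the span of $\{\pi(a)\xi : a \in A,\ \xi \in L^p(X,\mu)\}$ is dense in $L^p(X,\mu)$ (in particular $A$ is an $L^p$ operator algebra), and let $\alpha \colon G \to \mathrm{Aut}(A)$ be an action of $G$ on $A$ by isometric algebra automorphisms. Let $C_c(G, A, \alpha)$ be the algebra of finitely supported functions $G \to A$ with product $(ab)(g) = \sum_{h \in G} a(h)\, \alpha_h(b(h^{-1}g))$. A contractive covariant representation of $(G,A,\alpha)$ on a space $L^p(Y,\nu)$ is a pair $(v, \pi)$, where $v$ is a representation of $G$ by invertible operators with $\|v_g\| \le 1$ for all $g$ and $\pi \colon A \to L(L^p(Y,\nu))$ is a homomorphism with $\|\pi(a)\| \le \|a\|$ for all $a$, such that $\pi(\alpha_g(a)) = v_g \pi(a) v_g^{-1}$; set $(v \ltimes \pi)(f) = \sum_{g \in G} \pi(f(g))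 v_g$ for $f \in C_c(G,A,\alpha)$. The full $L^p$ operator crossed product $F^p(G, A, \alpha)$ is the Hausdorff completion of $C_c(G, A, \alpha)$ in the seminorm $f \mapsto \sup \|(v \ltimes \pi)(f)\|$, the supremum being over all contractive covariant representations $(v,\pi)$ on $L^p$ spaces of $\sigma$-finite measures for which $\pi$ is nondegenerate. The reduced crossed product $F^p_{\mathrm{r}}(G, A, \alpha)$ is defined in the same way, with the supremum only over the regular covariant representations: those on $L^p(G \times X, \text{counting} \times \mu)$ given by $(v_g \xi)(h) = \xi(g^{-1}h)$ and $(\pi(a)\xi)(h) = \pi_0(\alpha_h^{-1}(a))(\xi(h))$, where $\mu$ is $\sigma$-finite and $\pi_0$ is a nondegenerate contractive representation of $A$ on $L^p(X,\mu)$. A Banach algebra $B$ is amenable if for every Banach $B$-bimodule $E$, every bounded derivation from $B$ into the dual bimodule $E^*$ is inner. If $A$ is amenable as a Banach algebra, then $F^p(G, A, \alpha)$ and $F^p_{\mathrm{r}}(G, A, \alpha)$ are amenable as Banach algebras. -/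

import Mathlib

open MeasureTheory
open scoped ENNReal

noncomputable section

namespace LpCrossed

/-! ### Amenable groups and amenable Banach algebras -/

/-- The space of bounded real-valued functions on `G`. -/
def boundedFunctions (G : Type*) : Submodule ℝ (G → ℝ) where
  carrier := {f | ∃ C : ℝ, ∀ x, |f x| ≤ C}
  add_mem' := by
    rintro f g ⟨C, hC⟩ ⟨D, hD⟩
    exact ⟨C + D, fun x => (abs_add_le _ _).trans (add_le_add (hC x) (hD x))⟩
  zero_mem' := ⟨0, fun x => by simp⟩
  smul_mem' := by
    rintro c f ⟨C, hC⟩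
    exact ⟨|c| * C, fun x => by
      simpa [abs_mul] using mul_le_mul_of_nonneg_left (hC x) (abs_nonneg c)⟩

/-- Left translation `(g · f)(x) = f (g⁻¹ x)` of a bounded function. -/
def leftTranslate {G : Type*} [Group G] (g : G) (f : boundedFunctions G) : boundedFunctions G :=
  ⟨fun x => f.1 (g⁻¹ * x), by
    obtain ⟨C, hC⟩ := f.2
    exact ⟨C, fun x => hC _⟩⟩

/-- A discrete group is amenable if there is a left invariant mean on its bounded functions. -/
def IsAmenableGroup (G : Type*) [Group G] : Prop :=
  ∃ m : boundedFunctions G →ₗ[ℝ] ℝ,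
    (∀ f : boundedFunctions G, (∀ x, 0 ≤ f.1 x) → 0 ≤ m f) ∧
    (∀ f : boundedFunctions G, (∀ x, f.1 x = 1) → m f = 1) ∧
    ∀ (g : G) (f : boundedFunctions G), m (leftTranslate g f) = m f

/-- A Banach bimodule structure of the Banach algebra `B` on the Banach space `E`:
`left b x` is `b · x` and `right b x` is `x · b`. Continuity of `left` and `right` as maps into the
bounded operators is joint boundedness of the two module operations. -/
structure BanachBimodule (B E : Type*) [NonUnitalNormedRing B] [NormedSpace ℂ B]
    [NormedAddCommGroup E] [NormedSpace ℂ E] where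
  left : B →L[ℂ] E →L[ℂ] E
  right : B →L[ℂ] E →L[ℂ] E
  left_mul : ∀ a b x, left (a * b) x = left a (left b x)
  right_mul : ∀ a b x, right (a * b) x = right b (right a x)
  left_right : ∀ a b x, left a (right b x) = right b (left a x)

/-- A Banach algebra `B` is amenable if for every Banach `B`-bimodule `E`, every bounded derivation
`D : B → E*` into the dual bimodule is inner. Here `(b · φ)(x) = φ (x · b)` and
`(φ · b)(x) = φ (b · x)`, a derivation satisfies `D (a b) = a · D b + D a · b`, and it is inner if
`D a = a · φ - φ · a` for some `φ`. The bimodules range over any universe at least that of `B`. -/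
def IsAmenableBanachAlgebra.{u, e} (B : Type u) [NonUnitalNormedRing B] [NormedSpace ℂ B]
    [IsScalarTower ℂ B B] [SMulCommClass ℂ B B] [CompleteSpace B] : Prop :=
  ∀ (E : Type (max u e)) [NormedAddCommGroup E] [NormedSpace ℂ E] [CompleteSpace E]
    (M : BanachBimodule B E) (D : B →L[ℂ] (E →L[ℂ] ℂ)),
    (∀ a b x, D (a * b) x = D b (M.right a x) + D a (M.left b x)) →
    ∃ φ : E →L[ℂ] ℂ, ∀ a x, D a x = φ (M.right a x) - φ (M.left a x)

/-! ### Representations -/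

section Representations

variable {A E : Type*} [NormedRing A] [NormedAlgebra ℂ A] [NormedAddCommGroup E] [NormedSpace ℂ E]

/-- `‖π a‖ ≤ ‖a‖` for all `a`. -/
def IsContractiveRep (π : A →ₙₐ[ℂ] (E →L[ℂ] E)) : Prop := ∀ a, ‖π a‖ ≤ ‖a‖

/-- `‖π a‖ = ‖a‖` for all `a`. -/
def IsIsometricRep (π : A →ₙₐ[ℂ] (E →L[ℂ] E)) : Prop := ∀ a, ‖π a‖ = ‖a‖

/-- The span of `{π a ξ}` is dense in `E`. -/
def IsNondegenerateRep (π : A →ₙₐ[ℂ] (E →L[ℂ] E)) : Prop :=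
  Dense (Submodule.span ℂ {η : E | ∃ (a : A) (ξ : E), π a ξ = η} : Set E)

end Representations

/-- `A` has a nondegenerate isometric representation on `L^p(X, μ)` for some `σ`-finite `μ`. -/
def IsNondegSigmaFinitelyRepresentable.{u, w} (p : ℝ≥0∞) [Fact (1 ≤ p)] (A : Type u) [NormedRing A]
    [NormedAlgebra ℂ A] : Prop :=
  ∃ (X : Type w) (_ : MeasurableSpace X) (μ : Measure X), SigmaFinite μ ∧
    ∃ π : A →ₙₐ[ℂ] (Lp ℂ p μ →L[ℂ] Lp ℂ p μ), IsIsometricRep π ∧ IsNondegenerateRep π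

/-! ### Covariant representations of a discrete group acting on `A` -/

/-- A covariant representation `(v, π)` of `(G, A, α)` on `E`, for a discrete group `G` acting by
`α_g a = g • a`: `v` is a representation of `G` by invertible operators, `π` is a continuous
representation of `A`, and `π (α_g a) = v_g π(a) v_g⁻¹`. -/
structure CovariantRep (G A E : Type*) [Group G] [NormedRing A] [NormedAlgebra ℂ A]
    [MulSemiringAction G A] [NormedAddCommGroup E] [NormedSpace ℂ E] where
  v : G →* (E →L[ℂ] E)ˣ
  π : A →ₙₐ[ℂ] (E →L[ℂ] E)
  continuous_π : Continuous π
  covariance : ∀ (g : G) (a : A),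
    π (g • a) = (v g : E →L[ℂ] E) * π a * ((v g)⁻¹ : (E →L[ℂ] E)ˣ)

namespace CovariantRep

variable {G A E : Type*} [Group G] [NormedRing A] [NormedAlgebra ℂ A]
  [MulSemiringAction G A] [NormedAddCommGroup E] [NormedSpace ℂ E]

/-- `‖v_g‖ ≤ 1` for all `g`, and `π` is contractive. -/
def IsContractive (r : CovariantRep G A E) : Prop :=
  (∀ g, ‖(r.v g : E →L[ℂ] E)‖ ≤ 1) ∧ IsContractiveRep r.π

/-- The integrated form `(v ⋉ π)(f) = ∑ g, π (f g) v_g`. The finitely supported functions `G → A`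
with the product `(f f')(g) = ∑ h, f h · α_h (f' (h⁻¹ g))` are `SkewMonoidAlgebra A G`. -/
def integrated (r : CovariantRep G A E) (f : SkewMonoidAlgebra A G) : E →L[ℂ] E :=
  f.sum fun g a => r.π a * (r.v g : E →L[ℂ] E)

lemma integrated_single (r : CovariantRep G A E) (g : G) (a : A) :
    r.integrated (.single g a) = r.π a * (r.v g : E →L[ℂ] E) :=
  SkewMonoidAlgebra.sum_single_index (by simp)

lemma integrated_add (r : CovariantRep G A E) (f f' : SkewMonoidAlgebra A G) :
    r.integrated (f + f') = r.integrated f + r.integrated f' :=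
  SkewMonoidAlgebra.sum_add_index' (by simp) (by simp [add_mul])

lemma integrated_zero (r : CovariantRep G A E) : r.integrated (0 : SkewMonoidAlgebra A G) = 0 :=
  SkewMonoidAlgebra.sum_zero_index

lemma integrated_neg (r : CovariantRep G A E) (f : SkewMonoidAlgebra A G) :
    r.integrated (-f) = -r.integrated f := by
  rw [eq_neg_iff_add_eq_zero, ← integrated_add, neg_add_cancel, integrated_zero]

lemma integrated_smul (r : CovariantRep G A E) (c : ℂ) (f : SkewMonoidAlgebra A G) :
    r.integrated (c • f) = c • r.integrated f := by
  induction f with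
  | single g a => rw [SkewMonoidAlgebra.smul_single, integrated_single, integrated_single,
      map_smul, smul_mul_assoc]
  | add f f' h h' => rw [smul_add, integrated_add, integrated_add, h, h', smul_add]

lemma integrated_mul (r : CovariantRep G A E) (f f' : SkewMonoidAlgebra A G) :
    r.integrated (f * f') = r.integrated f * r.integrated f' := by
  induction f with
  | single g a =>
    induction f' with
    | single h b =>
      rw [SkewMonoidAlgebra.single_mul_single, integrated_single, integrated_single,
        integrated_single, map_mul, map_mul, r.covariance, Units.val_mul]
      simp only [mul_assoc]
      rw [← mul_assoc ((r.v g)⁻¹ : (E →L[ℂ] E)ˣ).val, Units.inv_mul, one_mul]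
    | add f f' h h' => rw [mul_add, integrated_add, integrated_add, h, h', mul_add]
  | add f f'' h h' => rw [add_mul, integrated_add, integrated_add, h, h', add_mul]

lemma norm_integrated_le (r : CovariantRep G A E) (hr : r.IsContractive)
    (f : SkewMonoidAlgebra A G) :
    ‖r.integrated f‖ ≤ ∑ g ∈ f.support, ‖f.coeff g‖ := by
  refine (norm_sum_le _ _).trans (Finset.sum_le_sum fun g _ => ?_)
  refine (norm_mul_le _ _).trans ?_
  simpa using mul_le_mul (hr.2 (f.coeff g)) (hr.1 g) (norm_nonneg _) (norm_nonneg _)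

end CovariantRep

/-! ### The crossed product of a family of contractive covariant representations -/

section Crossed

variable {G A : Type*} [Group G] [NormedRing A] [NormedAlgebra ℂ A] [MulSemiringAction G A]
  {ι : Type*} {E : ι → Type*} [∀ i, NormedAddCommGroup (E i)] [∀ i, NormedSpace ℂ (E i)]

/-- The seminorm `f ↦ sup_i ‖(v_i ⋉ π_i)(f)‖` of a family of contractive covariant
representations. -/
def crossedSeminorm (ρ : ∀ i, CovariantRep G A (E i)) (hρ : ∀ i, (ρ i).IsContractive) :
    RingSeminorm (SkewMonoidAlgebra A G) where
  toFun f := ⨆ i, ‖(ρ i).integrated f‖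
  map_zero' := by simp [CovariantRep.integrated_zero]
  add_le' f f' := by
    have hb : ∀ f, BddAbove (Set.range fun i => ‖(ρ i).integrated f‖) := fun f =>
      ⟨_, by rintro _ ⟨i, rfl⟩; exact (ρ i).norm_integrated_le (hρ i) f⟩
    refine Real.iSup_le (fun i => ?_) (add_nonneg (Real.iSup_nonneg fun _ => norm_nonneg _)
      (Real.iSup_nonneg fun _ => norm_nonneg _))
    rw [CovariantRep.integrated_add]
    exact (norm_add_le _ _).trans (add_le_add (le_ciSup (hb f) i) (le_ciSup (hb f') i))
  neg' f := by simp [CovariantRep.integrated_neg]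
  mul_le' f f' := by
    have hb : ∀ f, BddAbove (Set.range fun i => ‖(ρ i).integrated f‖) := fun f =>
      ⟨_, by rintro _ ⟨i, rfl⟩; exact (ρ i).norm_integrated_le (hρ i) f⟩
    refine Real.iSup_le (fun i => ?_) (mul_nonneg (Real.iSup_nonneg fun _ => norm_nonneg _)
      (Real.iSup_nonneg fun _ => norm_nonneg _))
    rw [CovariantRep.integrated_mul]
    exact (norm_mul_le _ _).trans (mul_le_mul (le_ciSup (hb f) i) (le_ciSup (hb f') i)
      (norm_nonneg _) (Real.iSup_nonneg fun _ => norm_nonneg _))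

/-- The algebra of finitely supported functions `G → A`, as a type carrying the seminorm
`crossedSeminorm ρ hρ`. -/
def SeminormedCore (ρ : ∀ i, CovariantRep G A (E i)) (_hρ : ∀ i, (ρ i).IsContractive) : Type _ :=
  SkewMonoidAlgebra A G

variable (ρ : ∀ i, CovariantRep G A (E i)) (hρ : ∀ i, (ρ i).IsContractive)

instance SeminormedCore.instRing : Ring (SeminormedCore ρ hρ) :=
  inferInstanceAs (Ring (SkewMonoidAlgebra A G))

instance SeminormedCore.instSeminormedRing : SeminormedRing (SeminormedCore ρ hρ) :=
  { SeminormedCore.instRing ρ hρ,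
    AddGroupSeminorm.toSeminormedAddCommGroup (E := SeminormedCore ρ hρ)
      (crossedSeminorm ρ hρ).toAddGroupSeminorm with
    norm_mul_le := (crossedSeminorm ρ hρ).mul_le' }

lemma SeminormedCore.norm_def (f : SeminormedCore ρ hρ) :
    ‖f‖ = ⨆ i, ‖(ρ i).integrated f‖ := rfl

variable [SMulCommClass G ℂ A]

instance SeminormedCore.instAlgebra : Algebra ℂ (SeminormedCore ρ hρ) :=
  inferInstanceAs (Algebra ℂ (SkewMonoidAlgebra A G))

instance SeminormedCore.instNormedAlgebra : NormedAlgebra ℂ (SeminormedCore ρ hρ) :=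
  { SeminormedCore.instAlgebra ρ hρ with
    norm_smul_le := fun c f => by
      have h : ∀ f : SkewMonoidAlgebra A G,
          ⨆ i, ‖(ρ i).integrated (c • f)‖ ≤ ‖c‖ * ⨆ i, ‖(ρ i).integrated f‖ := fun f => by
        simp_rw [CovariantRep.integrated_smul, norm_smul]
        rw [Real.mul_iSup_of_nonneg (norm_nonneg c)]
      exact h f }

/-- The Banach algebra obtained as the Hausdorff completion of the finitely supported functions
`G → A` in the seminorm `sup_i ‖(v_i ⋉ π_i)(f)‖`. -/
def CrossedProduct : Type _ := UniformSpace.Completion (SeminormedCore ρ hρ)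

instance CrossedProduct.instNormedRing : NormedRing (CrossedProduct ρ hρ) :=
  inferInstanceAs (NormedRing (UniformSpace.Completion (SeminormedCore ρ hρ)))

instance CrossedProduct.instAlgebra : Algebra ℂ (CrossedProduct ρ hρ) :=
  inferInstanceAs (Algebra ℂ (UniformSpace.Completion (SeminormedCore ρ hρ)))

instance CrossedProduct.instNormedAlgebra : NormedAlgebra ℂ (CrossedProduct ρ hρ) :=
  { CrossedProduct.instAlgebra ρ hρ with
    norm_smul_le := fun c x =>
      norm_smul_le c (show UniformSpace.Completion (SeminormedCore ρ hρ) from x) }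

instance CrossedProduct.instCompleteSpace : CompleteSpace (CrossedProduct ρ hρ) :=
  inferInstanceAs (CompleteSpace (UniformSpace.Completion (SeminormedCore ρ hρ)))

end Crossed

/-! ### The full crossed product -/

/-- A nondegenerate `σ`-finite contractive covariant representation of `(G, A, α)` on an
`L^p` space; the underlying set of the measure space lies in an arbitrary fixed universe. -/
structure FullRep.{u, v, w} (p : ℝ≥0∞) [Fact (1 ≤ p)] (G : Type v) (A : Type u) [Group G]
    [NormedRing A] [NormedAlgebra ℂ A] [MulSemiringAction G A] : Type (max u v (w + 1)) where
  X : Type w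
  [measurableSpace : MeasurableSpace X]
  μ : Measure X
  [sigmaFinite : SigmaFinite μ]
  rep : CovariantRep G A (Lp ℂ p μ)
  contractive : rep.IsContractive
  nondegenerate : IsNondegenerateRep rep.π

attribute [instance] FullRep.measurableSpace FullRep.sigmaFinite

/-- The full crossed product `F^p(G, A, α)`. -/
abbrev FullCrossedProduct.{u, v, w} (p : ℝ≥0∞) [Fact (1 ≤ p)] (G : Type v) (A : Type u) [Group G]
    [NormedRing A] [NormedAlgebra ℂ A] [MulSemiringAction G A] : Type (max u v) :=
  CrossedProduct (ι := FullRep.{u, v, w} p G A) (E := fun r => Lp ℂ p r.μ)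
    (fun r => r.rep) (fun r => r.contractive)

/-! ### Regular covariant representations -/

section Regular

lemma norm_smul_eq_of_isometric {G A : Type*} [Group G] [NormedRing A] [MulSemiringAction G A]
    [IsIsometricSMul G A] (g : G) (a : A) : ‖g • a‖ = ‖a‖ := by
  simpa using dist_smul g a 0

lemma exponent_ne_zero (p : ℝ≥0∞) [Fact (1 ≤ p)] : p ≠ 0 :=
  (zero_lt_one.trans_le (Fact.out : 1 ≤ p)).ne'

lemma exponent_toReal_pos (p : ℝ≥0∞) [Fact (1 ≤ p)] [Fact (p ≠ ∞)] : 0 < p.toReal :=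
  ENNReal.toReal_pos (exponent_ne_zero p) Fact.out

variable {G A E F : Type*} [Group G] [NormedRing A] [NormedAlgebra ℂ A] [MulSemiringAction G A]
  [NormedAddCommGroup E] [NormedSpace ℂ E] [NormedAddCommGroup F] [NormedSpace ℂ F]
  {p : ℝ≥0∞} [Fact (1 ≤ p)]

/-- The operator `(T ξ)(h) = T_h (ξ h)` on `l^p(G, E)`, for a bounded family `T_h`. -/
def lpDiag (T : G → E →L[ℂ] E) (C : ℝ) (hT : ∀ h, ‖T h‖ ≤ C) :
    lp (fun _ : G => E) p →L[ℂ] lp (fun _ : G => E) p :=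
  have hle (ξ : lp (fun _ : G => E) p) (h : G) :
      ‖T h (ξ h)‖ ≤ ‖((C : ℂ) • (ξ : ∀ _ : G, E)) h‖ := by
    have hC : 0 ≤ C := (norm_nonneg _).trans (hT h)
    rw [Pi.smul_apply, norm_smul, Complex.norm_of_nonneg hC]
    exact (T h).le_of_opNorm_le (hT h) _
  LinearMap.mkContinuous
    { toFun ξ := ⟨fun h => T h (ξ h), ((lp.memℓp ξ).const_smul (C : ℂ)).mono' (hle ξ)⟩
      map_add' ξ η := by ext h; exact map_add (T h) (ξ h) (η h)
      map_smul' c ξ := by ext h; simp } C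
    (fun ξ => by
      have hC : 0 ≤ C := (norm_nonneg _).trans (hT 1)
      refine (lp.norm_mono (exponent_ne_zero p) (y := (C : ℂ) • ξ) (hle ξ)).trans ?_
      rw [norm_smul, Complex.norm_of_nonneg hC])

@[simp] lemma lpDiag_apply (T : G → E →L[ℂ] E) (C : ℝ) (hT : ∀ h, ‖T h‖ ≤ C)
    (ξ : lp (fun _ : G => E) p) (h : G) : lpDiag T C hT ξ h = T h (ξ h) := rfl

lemma norm_lpDiag_le (T : G → E →L[ℂ] E) (C : ℝ) (hT : ∀ h, ‖T h‖ ≤ C) :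
    ‖(lpDiag T C hT : lp (fun _ : G => E) p →L[ℂ] _)‖ ≤ C := by
  unfold lpDiag
  exact LinearMap.mkContinuous_norm_le _ ((norm_nonneg (T 1)).trans (hT 1)) _

variable [Fact (p ≠ ∞)]

/-- The operator `(v_g ξ)(h) = ξ (g⁻¹ h)` on `l^p(G, E)`. -/
def lpShift (g : G) : lp (fun _ : G => E) p →L[ℂ] lp (fun _ : G => E) p :=
  LinearMap.mkContinuous
    { toFun ξ := ⟨fun h => ξ (g⁻¹ * h), (memℓp_gen_iff (exponent_toReal_pos p)).2
        ((Equiv.mulLeft g⁻¹).summable_iff.2 ((lp.memℓp ξ).summable (exponent_toReal_pos p)))⟩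
      map_add' ξ η := by ext h; rfl
      map_smul' c ξ := by ext h; rfl } 1
    (fun ξ => by
      rw [one_mul, lp.norm_eq_tsum_rpow (exponent_toReal_pos p),
        lp.norm_eq_tsum_rpow (exponent_toReal_pos p)]
      exact le_of_eq (congrArg (· ^ (1 / p.toReal))
        ((Equiv.mulLeft g⁻¹).tsum_eq fun h => ‖ξ h‖ ^ p.toReal)))

@[simp] lemma lpShift_apply (g : G) (ξ : lp (fun _ : G => E) p) (h : G) :
    lpShift g ξ h = ξ (g⁻¹ * h) := rfl

lemma norm_lpShift_le (g : G) : ‖(lpShift g : lp (fun _ : G => E) p →L[ℂ] _)‖ ≤ 1 :=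
  LinearMap.mkContinuous_norm_le _ zero_le_one _

section Rep

variable [SMulCommClass G ℂ A] [IsIsometricSMul G A]

/-- The regular covariant representation on `l^p(G, E)` of a contractive representation `π₀` of `A`
on `E`: `(v_g ξ)(h) = ξ (g⁻¹ h)` and `(π(a) ξ)(h) = π₀ (α_h⁻¹ a) (ξ h)`. -/
def regularLp (p : ℝ≥0∞) [Fact (1 ≤ p)] [Fact (p ≠ ∞)] (π₀ : A →ₙₐ[ℂ] (E →L[ℂ] E))
    (hπ₀ : IsContractiveRep π₀) : CovariantRep G A (lp (fun _ : G => E) p) :=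
  have hb (a : A) (h : G) : ‖π₀ (h⁻¹ • a)‖ ≤ ‖a‖ :=
    (hπ₀ _).trans_eq (norm_smul_eq_of_isometric h⁻¹ a)
  let π : A →ₙₐ[ℂ] (lp (fun _ : G => E) p →L[ℂ] lp (fun _ : G => E) p) :=
    { toFun a := lpDiag (fun h => π₀ (h⁻¹ • a)) ‖a‖ (hb a)
      map_smul' c a := by ext ξ h; simp [smul_comm _ c a]
      map_zero' := by ext ξ h; simp
      map_add' a b := by ext ξ h; simp
      map_mul' a b := by ext ξ h; simp }
  { v := (MonoidHom.mk' (fun g => ⟨lpShift g, lpShift g⁻¹, by ext ξ h; simp, by ext ξ h; simp⟩)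
      (fun g g' => by ext ξ h; simp [mul_assoc]))
    π := π
    continuous_π := AddMonoidHomClass.continuous_of_bound π 1 fun a => by
      rw [one_mul]; exact norm_lpDiag_le _ _ (hb a)
    covariance g a := by
      ext ξ h
      simp [π, mul_smul] }

lemma regularLp_isContractive (π₀ : A →ₙₐ[ℂ] (E →L[ℂ] E)) (hπ₀ : IsContractiveRep π₀) :
    (regularLp (G := G) p π₀ hπ₀).IsContractive :=
  ⟨fun g => norm_lpShift_le g, fun a => norm_lpDiag_le _ _ fun h =>
    (hπ₀ _).trans_eq (norm_smul_eq_of_isometric h⁻¹ a)⟩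

end Rep

/-- Transport of a covariant representation along a linear isometric bijection. -/
def CovariantRep.transport (r : CovariantRep G A E) (e : E ≃ₗᵢ[ℂ] F) : CovariantRep G A F where
  v := (Units.map (e.toContinuousLinearEquiv.conjContinuousAlgEquiv :
    (E →L[ℂ] E) →* (F →L[ℂ] F))).comp r.v
  π := (e.toContinuousLinearEquiv.conjContinuousAlgEquiv :
    (E →L[ℂ] E) →ₙₐ[ℂ] (F →L[ℂ] F)).comp r.π
  continuous_π := e.toContinuousLinearEquiv.conjContinuousAlgEquiv.continuous.comp r.continuous_π
  covariance g a := by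
    rw [NonUnitalAlgHom.comp_apply, r.covariance, map_mul, map_mul]
    rfl

lemma norm_conj_le (e : E ≃ₗᵢ[ℂ] F) (T : E →L[ℂ] E) :
    ‖e.toContinuousLinearEquiv.conjContinuousAlgEquiv T‖ ≤ ‖T‖ :=
  ContinuousLinearMap.opNorm_le_bound _ (norm_nonneg _) fun x => by
    have := T.le_opNorm (e.symm x)
    rw [e.symm.norm_map] at this
    exact (e.norm_map _).trans_le this

lemma CovariantRep.transport_isContractive (r : CovariantRep G A E) (e : E ≃ₗᵢ[ℂ] F)
    (hr : r.IsContractive) : (r.transport e).IsContractive :=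
  ⟨fun g => (norm_conj_le e _).trans (hr.1 g), fun a => (norm_conj_le e _).trans (hr.2 a)⟩

end Regular

/-! ### The identification of `L^p(G × X, ν × μ)` with `l^p(G, L^p(X, μ))` -/

section Slices

set_option linter.unusedSectionVars false

variable {G X : Type*} [Countable G] [MeasurableSpace G] [DiscreteMeasurableSpace G]
  [MeasurableSpace X] {μ : Measure X} [SigmaFinite μ] {p : ℝ≥0∞} [Fact (1 ≤ p)] [Fact (p ≠ ∞)]

lemma eLpNorm_rpow_eq_lintegral {Y : Type*} [MeasurableSpace Y] (m : Measure Y) (f : Y → ℂ) :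
    eLpNorm f p m ^ p.toReal = ∫⁻ y, ‖f y‖ₑ ^ p.toReal ∂m := by
  rw [eLpNorm_eq_lintegral_rpow_enorm_toReal (exponent_ne_zero p) Fact.out, ← ENNReal.rpow_mul,
    one_div, inv_mul_cancel₀ (exponent_toReal_pos p).ne', ENNReal.rpow_one]

lemma eLpNorm_count_prod_rpow {f : G × X → ℂ}
    (hf : AEStronglyMeasurable f ((Measure.count : Measure G).prod μ)) :
    eLpNorm f p ((Measure.count : Measure G).prod μ) ^ p.toReal =
      ∑' h, eLpNorm (fun x => f (h, x)) p μ ^ p.toReal := by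
  simp only [eLpNorm_rpow_eq_lintegral]
  rw [lintegral_prod _ (hf.enorm.pow_const _), lintegral_count]

lemma aestronglyMeasurable_slice {f : G × X → ℂ}
    (hf : AEStronglyMeasurable f ((Measure.count : Measure G).prod μ)) (h : G) :
    AEStronglyMeasurable (fun x => f (h, x)) μ :=
  Measure.ae_count_iff.1 hf.prodMk_left h

lemma memLp_slice {f : G × X → ℂ} (hf : MemLp f p ((Measure.count : Measure G).prod μ)) (h : G) :
    MemLp (fun x => f (h, x)) p μ := by
  refine ⟨aestronglyMeasurable_slice hf.1 h, ?_⟩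
  have hpos := exponent_toReal_pos p
  have h1 := ENNReal.rpow_lt_top_of_nonneg hpos.le hf.2.ne
  rw [eLpNorm_count_prod_rpow hf.1] at h1
  exact (ENNReal.rpow_lt_top_iff_of_pos hpos).1
    ((ENNReal.le_tsum (f := fun h => eLpNorm (fun x => f (h, x)) p μ ^ p.toReal) h).trans_lt h1)

/-- The slice `ξ(h, ·)` of `ξ ∈ L^p(G × X, ν × μ)`, where `ν` is counting measure. -/
def slice (ξ : Lp ℂ p ((Measure.count : Measure G).prod μ)) (h : G) : Lp ℂ p μ :=
  (memLp_slice (Lp.memLp ξ) h).toLp _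

lemma coeFn_slice (ξ : Lp ℂ p ((Measure.count : Measure G).prod μ)) (h : G) :
    slice ξ h =ᵐ[μ] fun x => ξ (h, x) := MemLp.coeFn_toLp _

lemma slice_eq_of_ae {ξ : Lp ℂ p ((Measure.count : Measure G).prod μ)} {f : G × X → ℂ}
    (hf : ξ =ᵐ[(Measure.count : Measure G).prod μ] f) (h : G) :
    slice ξ h =ᵐ[μ] fun x => f (h, x) :=
  (coeFn_slice ξ h).trans (Measure.ae_count_iff.1 (Measure.ae_ae_of_ae_prod hf) h)

lemma slice_add (ξ η : Lp ℂ p ((Measure.count : Measure G).prod μ)) (h : G) :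
    slice (ξ + η) h = slice ξ h + slice η h := by
  apply Lp.ext
  filter_upwards [slice_eq_of_ae (Lp.coeFn_add ξ η) h, coeFn_slice ξ h, coeFn_slice η h,
    Lp.coeFn_add (slice ξ h) (slice η h)] with x h1 h2 h3 h4
  rw [h1, h4, Pi.add_apply, Pi.add_apply, h2, h3]

lemma slice_smul (c : ℂ) (ξ : Lp ℂ p ((Measure.count : Measure G).prod μ)) (h : G) :
    slice (c • ξ) h = c • slice ξ h := by
  apply Lp.ext
  filter_upwards [slice_eq_of_ae (Lp.coeFn_smul c ξ) h, coeFn_slice ξ h,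
    Lp.coeFn_smul c (slice ξ h)] with x h1 h2 h3
  rw [h1, h3, Pi.smul_apply, Pi.smul_apply, h2]

lemma ofReal_norm_rpow {Y : Type*} [MeasurableSpace Y] {m : Measure Y} (ξ : Lp ℂ p m) :
    ENNReal.ofReal (‖ξ‖ ^ p.toReal) = eLpNorm ξ p m ^ p.toReal := by
  rw [← ENNReal.ofReal_rpow_of_nonneg (norm_nonneg _) ENNReal.toReal_nonneg, Lp.norm_def,
    ENNReal.ofReal_toReal (Lp.eLpNorm_ne_top ξ)]

lemma tsum_norm_slice (ξ : Lp ℂ p ((Measure.count : Measure G).prod μ)) :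
    ∑' h, ENNReal.ofReal (‖slice ξ h‖ ^ p.toReal) = ENNReal.ofReal (‖ξ‖ ^ p.toReal) := by
  rw [ofReal_norm_rpow, eLpNorm_count_prod_rpow (Lp.aestronglyMeasurable ξ)]
  exact tsum_congr fun h => by rw [ofReal_norm_rpow, eLpNorm_congr_ae (coeFn_slice ξ h)]

lemma hasSum_norm_slice (ξ : Lp ℂ p ((Measure.count : Measure G).prod μ)) :
    HasSum (fun h => ‖slice ξ h‖ ^ p.toReal) (‖ξ‖ ^ p.toReal) := by
  have h0 : ∀ h, 0 ≤ ‖slice ξ h‖ ^ p.toReal := fun h => by positivity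
  have h1 := tsum_norm_slice ξ
  have hs : Summable fun h => ‖slice ξ h‖ ^ p.toReal := by
    have h2 := ENNReal.summable_toReal (h1.trans_ne ENNReal.ofReal_ne_top)
    simpa only [ENNReal.toReal_ofReal (h0 _)] using h2
  rw [← ENNReal.ofReal_tsum_of_nonneg h0 hs,
    ENNReal.ofReal_eq_ofReal_iff (tsum_nonneg h0) (by positivity)] at h1
  exact h1 ▸ hs.hasSum

lemma memLp_glue (η : lp (fun _ : G => Lp ℂ p μ) p) :
    MemLp (fun z : G × X => η z.1 z.2) p ((Measure.count : Measure G).prod μ) := by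
  have hm : Measurable (fun z : G × X => η z.1 z.2) :=
    measurable_from_prod_countable_right fun h => (Lp.stronglyMeasurable (η h)).measurable
  refine ⟨hm.aestronglyMeasurable, ?_⟩
  have hpos := exponent_toReal_pos p
  rw [← ENNReal.rpow_lt_top_iff_of_pos hpos, eLpNorm_count_prod_rpow hm.aestronglyMeasurable]
  simp only [← ofReal_norm_rpow]
  rw [← ENNReal.ofReal_tsum_of_nonneg (fun h => by positivity) ((lp.memℓp η).summable hpos)]
  exact ENNReal.ofReal_lt_top

/-- The isometric isomorphism from `L^p(G × X, ν × μ)` (with `ν` counting measure) to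
`l^p(G, L^p(X, μ))`, sending `ξ` to `h ↦ ξ(h, ·)`. -/
def sliceEquiv (G : Type*) [Countable G] [MeasurableSpace G] [DiscreteMeasurableSpace G]
    (p : ℝ≥0∞) [Fact (1 ≤ p)] [Fact (p ≠ ∞)] (μ : Measure X) [SigmaFinite μ] :
    Lp ℂ p ((Measure.count : Measure G).prod μ) ≃ₗᵢ[ℂ] lp (fun _ : G => Lp ℂ p μ) p :=
  LinearIsometryEquiv.ofSurjective
    { toFun ξ := ⟨slice ξ,
        (memℓp_gen_iff (exponent_toReal_pos p)).2 (hasSum_norm_slice ξ).summable⟩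
      map_add' ξ η := by ext1; funext h; exact slice_add ξ η h
      map_smul' c ξ := by ext1; funext h; exact slice_smul c ξ h
      norm_map' ξ := by
        have hpos := exponent_toReal_pos p
        rw [lp.norm_eq_tsum_rpow hpos]
        change (∑' h, ‖slice ξ h‖ ^ p.toReal) ^ (1 / p.toReal) = ‖ξ‖
        rw [(hasSum_norm_slice ξ).tsum_eq, one_div, Real.rpow_rpow_inv (norm_nonneg _) hpos.ne'] }
    (fun η => ⟨(memLp_glue η).toLp _, by
      ext1; funext h
      exact Lp.ext (slice_eq_of_ae (MemLp.coeFn_toLp (memLp_glue η)) h)⟩)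

lemma sliceEquiv_apply (ξ : Lp ℂ p ((Measure.count : Measure G).prod μ)) (h : G) :
    sliceEquiv G p μ ξ h =ᵐ[μ] fun x => ξ (h, x) := coeFn_slice ξ h

end Slices

/-! ### The reduced crossed product -/

/-- A nondegenerate `σ`-finite contractive representation of `A` on an `L^p` space. -/
structure SigmaFiniteRep.{u, w} (p : ℝ≥0∞) [Fact (1 ≤ p)] (A : Type u)
    [NormedRing A] [NormedAlgebra ℂ A] : Type (max u (w + 1)) where
  X : Type w
  [measurableSpace : MeasurableSpace X]
  μ : Measure X
  [sigmaFinite : SigmaFinite μ]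
  π : A →ₙₐ[ℂ] (Lp ℂ p μ →L[ℂ] Lp ℂ p μ)
  contractive : IsContractiveRep π
  nondegenerate : IsNondegenerateRep π

attribute [instance] SigmaFiniteRep.measurableSpace SigmaFiniteRep.sigmaFinite

section Reduced

variable {p : ℝ≥0∞} [Fact (1 ≤ p)] [Fact (p ≠ ∞)]
  {A : Type*} [NormedRing A] [NormedAlgebra ℂ A]
  (G : Type*) [Group G] [Countable G] [MeasurableSpace G] [DiscreteMeasurableSpace G]
  [MulSemiringAction G A] [SMulCommClass G ℂ A] [IsIsometricSMul G A]

/-- The regular covariant representation on `L^p(G × X, ν × μ)`, with `ν` counting measure on `G`,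
associated with a contractive representation `π₀` of `A` on `L^p(X, μ)`. -/
def SigmaFiniteRep.regular (d : SigmaFiniteRep p A) :
    CovariantRep G A (Lp ℂ p ((Measure.count : Measure G).prod d.μ)) :=
  (regularLp p d.π d.contractive).transport (sliceEquiv G p d.μ).symm

lemma SigmaFiniteRep.regular_isContractive (d : SigmaFiniteRep p A) :
    (d.regular G).IsContractive :=
  (regularLp p d.π d.contractive).transport_isContractive _
    (regularLp_isContractive d.π d.contractive)

variable {G}

/-- `(v_g ξ)(h, x) = ξ(g⁻¹ h, x)`. -/
lemma SigmaFiniteRep.regular_v (d : SigmaFiniteRep p A) (g h : G)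
    (ξ : Lp ℂ p ((Measure.count : Measure G).prod d.μ)) :
    slice (((d.regular G).v g : _ →L[ℂ] _) ξ) h = slice ξ (g⁻¹ * h) :=
  congrArg (fun η : lp (fun _ : G => Lp ℂ p d.μ) p => η h)
    ((sliceEquiv G p d.μ).apply_symm_apply (lpShift g (sliceEquiv G p d.μ ξ)))

/-- `(π(a) ξ)(h) = π₀ (α_h⁻¹ a) (ξ(h))`. -/
lemma SigmaFiniteRep.regular_π (d : SigmaFiniteRep p A) (a : A) (h : G)
    (ξ : Lp ℂ p ((Measure.count : Measure G).prod d.μ)) :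
    slice ((d.regular G).π a ξ) h = d.π (h⁻¹ • a) (slice ξ h) :=
  congrArg (fun η : lp (fun _ : G => Lp ℂ p d.μ) p => η h)
    ((sliceEquiv G p d.μ).apply_symm_apply
      ((regularLp p d.π d.contractive).π a (sliceEquiv G p d.μ ξ)))

end Reduced

/-- The reduced crossed product `F^p_r(G, A, α)`. -/
abbrev ReducedCrossedProduct.{u, v, w} (p : ℝ≥0∞) [Fact (1 ≤ p)] [Fact (p ≠ ∞)]
    (G : Type v) (A : Type u) [Group G] [Countable G] [MeasurableSpace G]
    [DiscreteMeasurableSpace G] [NormedRing A] [NormedAlgebra ℂ A] [MulSemiringAction G A]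
    [SMulCommClass G ℂ A] [IsIsometricSMul G A] : Type (max u v) :=
  CrossedProduct (ι := SigmaFiniteRep.{u, w} p A)
    (E := fun d => Lp ℂ p ((Measure.count : Measure G).prod d.μ))
    (fun d => d.regular G) (fun d => d.regular_isContractive G)

end LpCrossed

end

universe u v w e

/-! This is Johnson's averaging argument. Write `u_g` for `s g 1`, and `a` for `s 1 a`. Given a
derivation `D` into a dual bimodule, amenability of `A` makes `D` inner on `A`; subtracting that
inner derivation leaves `D'` with `D' a = 0`. The functionals `ψ_g = D'(u_g) · u_{g⁻¹}` are
uniformly bounded and satisfy the cocycle identity `ψ_{gh} = u_g · ψ_h · u_{g⁻¹} + ψ_g`. Averaging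
them over `G` with an invariant mean gives `φ` with `D'(u_g) = φ · u_g - u_g · φ`. Each `ψ_g`
commutes with `A`, hence so does `φ`, and the inner derivation of `-φ` agrees with `D'` on all
products `a u_g`, whose span is dense.

`IsAmenableGroup.exists_dual_average` supplies the average and `isAmenableBanachAlgebra_of_skew`
runs the argument. The latter asks only for contractive maps `s g`, the skew product rule and
density. Any completion of the skew group algebra given by contractive covariant representations
provides these, so the full and reduced crossed products are treated together. -/

noncomputable section

namespace LpCrossed

/-! ### Averaging bounded families of functionals over an amenable group. -/

section Averaging

variable {G : Type*}

/-- `φ x` is the mean of `h ↦ ψ h x`. The implication packages left invariance, additivity and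
normalisation of the mean in the one form used later: an affine relation between `ψ (g * h)` and `ψ
h`, uniform in `h`, passes to `φ`. -/
lemma IsAmenableGroup.exists_dual_average [Group G] (hG : IsAmenableGroup G) {E : Type*}
    [NormedAddCommGroup E] [NormedSpace ℂ E] (ψ : G → E →L[ℂ] ℂ) (C : ℝ) (hψ : ∀ h, ‖ψ h‖ ≤ C) :
    ∃ φ : E →L[ℂ] ℂ, ∀ (g : G) (x y : E) (c : ℂ),
      (∀ h, ψ (g * h) x = ψ h y + c) → φ x = φ y + c := by
  obtain ⟨m, hm_nonneg, hm_one, hm_inv⟩ := hG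
  have hre (x : E) (h : G) : |(ψ h x).re| ≤ C * ‖x‖ :=
    (Complex.abs_re_le_norm _).trans ((ψ h).le_of_opNorm_le (hψ h) x)
  let const (c : ℝ) : boundedFunctions G := ⟨fun _ => c, |c|, fun _ => le_rfl⟩
  have hm_const (c : ℝ) : m (const c) = c := by
    have hc : const c = c • const 1 := by
      apply Subtype.ext
      funext h
      simp [const]
    rw [hc, map_smul, hm_one _ fun _ => rfl, smul_eq_mul, mul_one]
  have hm_mono (f f' : boundedFunctions G) (hf : ∀ h, f.1 h ≤ f'.1 h) : m f ≤ m f' := by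
    have := hm_nonneg (f' - f) fun h => sub_nonneg.2 (hf h)
    rwa [map_sub, sub_nonneg] at this
  let F (x : E) : boundedFunctions G := ⟨fun h => (ψ h x).re, C * ‖x‖, hre x⟩
  -- The mean is real-valued, so only real parts are averaged. Monotonicity against the constants
  -- `±C‖x‖` bounds the result.
  let r : StrongDual ℝ E := LinearMap.mkContinuous
    { toFun x := m (F x)
      map_add' x y := by
        rw [← map_add]
        congr 1
        apply Subtype.ext
        funext h
        simp [F]
      map_smul' t x := by
        rw [RingHom.id_apply, ← map_smul]
        congr 1
        apply Subtype.ext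
        funext h
        simp [F, ← Complex.coe_smul] }
    C fun x => by
      refine abs_le.2 ⟨?_, ?_⟩
      · rw [← hm_const (-(C * ‖x‖))]
        exact hm_mono _ _ fun h => (abs_le.1 (hre x h)).1
      · rw [← hm_const (C * ‖x‖)]
        exact hm_mono _ _ fun h => (abs_le.1 (hre x h)).2
  have hr (g : G) (x y : E) (c : ℂ) (hxy : ∀ h, ψ (g * h) x = ψ h y + c) :
      r x = r y + c.re := by
    change m (F x) = m (F y) + c.re
    -- Left translation by `g⁻¹` replaces the argument `h` by `g * h`.
    rw [← hm_inv g⁻¹ (F x), ← hm_const c.re, ← map_add]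
    congr 1
    apply Subtype.ext
    funext h
    simp [F, leftTranslate, const, hxy]
  -- The complex functional with real part `r` is `x ↦ r x - i r(ix)`. Its imaginary part is
  -- controlled by the same relation multiplied by `i`.
  refine ⟨r.extendRCLike, fun g x y c hxy => ?_⟩
  have h1 := hr g x y c hxy
  have h2 := hr g (Complex.I • x) (Complex.I • y) (Complex.I * c) fun h => by
    rw [map_smul, map_smul, hxy, smul_add, smul_eq_mul, smul_eq_mul]
  rw [StrongDual.extendRCLike_apply, StrongDual.extendRCLike_apply]
  apply Complex.ext
  · simp [h1]
  · simp [h2, add_comm]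

end Averaging

/-! ### Derivations into dual bimodules. -/

namespace BanachBimodule

variable {A B E : Type*} [NormedRing A] [NormedAlgebra ℂ A] [NormedRing B] [NormedAlgebra ℂ B]
  [NormedAddCommGroup E] [NormedSpace ℂ E]

/-- The derivation `b ↦ b · φ - φ · b` into the dual bimodule. -/
def innerDerivation (M : BanachBimodule B E) (φ : E →L[ℂ] ℂ) : B →L[ℂ] (E →L[ℂ] ℂ) :=
  (ContinuousLinearMap.compL ℂ E E ℂ φ).comp M.right -
    (ContinuousLinearMap.compL ℂ E E ℂ φ).comp M.left

@[simp] lemma innerDerivation_apply (M : BanachBimodule B E) (φ : E →L[ℂ] ℂ) (b : B) (x : E) :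
    M.innerDerivation φ b x = φ (M.right b x) - φ (M.left b x) := rfl

/-- The Leibniz rule for a map into the dual bimodule. -/
def IsDerivation (M : BanachBimodule B E) (D : B →L[ℂ] (E →L[ℂ] ℂ)) : Prop :=
  ∀ a b x, D (a * b) x = D b (M.right a x) + D a (M.left b x)

lemma isDerivation_innerDerivation (M : BanachBimodule B E) (φ : E →L[ℂ] ℂ) :
    M.IsDerivation (M.innerDerivation φ) := fun a b x => by
  simp only [innerDerivation_apply, M.left_mul, M.right_mul, M.left_right]
  ring

lemma IsDerivation.sub {M : BanachBimodule B E} {D D' : B →L[ℂ] (E →L[ℂ] ℂ)}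
    (hD : M.IsDerivation D) (hD' : M.IsDerivation D') : M.IsDerivation (D - D') := fun a b x => by
  simp only [sub_apply, hD a b x, hD' a b x]
  ring

/-- Restriction of scalars along a bounded multiplicative map. -/
def restrict (M : BanachBimodule B E) (f : A →L[ℂ] B) (hf : ∀ a b, f (a * b) = f a * f b) :
    BanachBimodule A E where
  left := M.left.comp f
  right := M.right.comp f
  left_mul a b x := by simp [hf, M.left_mul]
  right_mul a b x := by simp [hf, M.right_mul]
  left_right a b x := M.left_right _ _ _

end BanachBimodule

/-! ### The averaging argument for derivations. -/

/-- A Banach algebra densely spanned by a bounded copy of the skew group algebra of an amenable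
group over an amenable Banach algebra is amenable. -/
theorem isAmenableBanachAlgebra_of_skew {G : Type v} [Group G] (hG : IsAmenableGroup G)
    {A : Type u} [NormedRing A] [NormedAlgebra ℂ A] [CompleteSpace A] [MulSemiringAction G A]
    (hA : IsAmenableBanachAlgebra.{u, max v e} A)
    {B : Type (max u v)} [NormedRing B] [NormedAlgebra ℂ B] [CompleteSpace B]
    (s : G → A →L[ℂ] B) (hs_norm : ∀ g a, ‖s g a‖ ≤ ‖a‖)
    (hs_mul : ∀ g h a b, s g a * s h b = s (g * h) (a * g • b))
    (hs_dense : Dense (Submodule.span ℂ {b | ∃ g a, s g a = b} : Set B)) :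
    IsAmenableBanachAlgebra.{max u v, e} B := by
  intro E _ _ _ M D hD
  have hι (a b : A) : s 1 (a * b) = s 1 a * s 1 b := by rw [hs_mul, one_smul, mul_one]
  -- The parameter `max v e` in `hA` lets the same `E` serve as an `A`-bimodule.
  obtain ⟨φ₀, hφ₀⟩ := hA E (M.restrict (s 1) hι) (D.comp (s 1)) fun a b x => by
    rw [ContinuousLinearMap.comp_apply, hι]
    exact hD (s 1 a) (s 1 b) x
  set D' := D - M.innerDerivation φ₀ with hD'_def
  have hD' : M.IsDerivation D' :=
    BanachBimodule.IsDerivation.sub hD (M.isDerivation_innerDerivation φ₀)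
  have hD'A (a : A) : D' (s 1 a) = 0 := by
    ext x
    have := hφ₀ a x
    simp only [ContinuousLinearMap.comp_apply] at this
    simp [hD'_def, this, BanachBimodule.restrict]
  have hu (g h : G) : s g 1 * s h 1 = s (g * h) 1 := by rw [hs_mul, smul_one, mul_one]
  -- `E` need not be a unital bimodule, so `u_1` may fail to act as the identity; `D'(u_g)` absorbs
  -- it because `D'(u_1) = 0`.
  have hD'1 (g : G) (x : E) : D' (s g 1) (M.left (s 1 1) x) = D' (s g 1) x := by
    have := hD' (s g 1) (s 1 1) x
    rw [hu, mul_one, hD'A, zero_apply, zero_add] at this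
    exact this.symm
  let ψ (g : G) : E →L[ℂ] ℂ := (D' (s g 1)).comp (M.left (s g⁻¹ 1))
  have hψ (g : G) (x : E) : ψ g x = D' (s g 1) (M.left (s g⁻¹ 1) x) := rfl
  -- The bound is uniform in `h` because `‖u_h‖ ≤ ‖1‖`; the norm of `1` is not assumed to be `1`.
  obtain ⟨φ, hφ⟩ := hG.exists_dual_average ψ (‖D'‖ * ‖(1 : A)‖ * (‖M.left‖ * ‖(1 : A)‖)) fun h => by
    refine (ContinuousLinearMap.opNorm_comp_le _ _).trans ?_
    exact mul_le_mul (D'.le_opNorm_of_le (hs_norm h 1)) (M.left.le_opNorm_of_le (hs_norm h⁻¹ 1))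
      (norm_nonneg _) (by positivity)
  have hφ_eq (x y : E) (hxy : ∀ h, ψ h x = ψ h y) : φ x = φ y := by
    simpa using hφ 1 x y 0 fun h => by rw [one_mul, add_zero, hxy]
  have hφ1 (x : E) : φ (M.left (s 1 1) x) = φ x := hφ_eq _ _ fun h => by
    rw [hψ, hψ, ← M.left_mul, hu, mul_one]
  -- Each `ψ_h` commutes with `a`: expand `D'` on both sides of `a u_h = u_h (h⁻¹ • a)`, where the
  -- terms `D' a` and `D' (h⁻¹ • a)` vanish, then move `h⁻¹ • a` past `u_{h⁻¹}`.
  have hφA (a : A) (x : E) : φ (M.right (s 1 a) x) = φ (M.left (s 1 a) x) := hφ_eq _ _ fun h => by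
    have hcomm : s 1 a * s h 1 = s h 1 * s 1 (h⁻¹ • a) := by simp [hs_mul]
    have hcomm' : s 1 (h⁻¹ • a) * s h⁻¹ 1 = s h⁻¹ 1 * s 1 a := by simp [hs_mul]
    have h1 := hD' (s 1 a) (s h 1) (M.left (s h⁻¹ 1) x)
    have h2 := hD' (s h 1) (s 1 (h⁻¹ • a)) (M.left (s h⁻¹ 1) x)
    rw [hcomm, h2, hD'A, hD'A, zero_apply, zero_apply,
      zero_add, add_zero, ← M.left_mul, hcomm', M.left_mul] at h1
    rw [hψ, hψ, M.left_right, h1]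
  have hφG (g : G) (x : E) : D' (s g 1) x = φ (M.left (s g 1) x) - φ (M.right (s g 1) x) := by
    -- The cocycle identity evaluated at `u_g · x`, with `c = D'(u_g) x`. The factor `u_1` is what
    -- remains of `u_{g⁻¹} u_g`; `hφ1` removes it afterwards.
    have := hφ g (M.left (s g 1) x) (M.right (s g 1) (M.left (s 1 1) x)) (D' (s g 1) x) fun h => by
      rw [hψ, hψ, ← M.left_mul, hu, ← hu g h, hD', ← M.left_mul, hu, mul_inv_rev,
        inv_mul_cancel_right, mul_inv_cancel, hD'1, M.left_right, ← M.left_mul, hu, mul_one]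
    rw [this, ← M.left_right, hφ1, add_sub_cancel_left]
  refine ⟨φ₀ - φ, fun b x => ?_⟩
  suffices hker : D' = M.innerDerivation (-φ) by
    have := congrArg (fun T => T b x) hker
    simp only [hD'_def, sub_apply, BanachBimodule.innerDerivation_apply,
      neg_apply] at this
    rw [sub_eq_iff_eq_add] at this
    rw [this, sub_apply, sub_apply]
    ring
  refine ContinuousLinearMap.ext_on hs_dense ?_
  rintro _ ⟨g, a, rfl⟩
  ext y
  -- Both derivations vanish on `A`, so on `a u_g` each is `a` acting on its value at `u_g`, and
  -- these values agree by `hφG`.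
  have hga : s g a = s 1 a * s g 1 := by rw [hs_mul, one_smul, mul_one, one_mul]
  rw [hga, hD', M.isDerivation_innerDerivation, hD'A, hφG, BanachBimodule.innerDerivation_apply,
    BanachBimodule.innerDerivation_apply]
  simp only [neg_apply, zero_apply, hφA]
  ring

/-! ### Crossed products as completions of the skew group algebra. -/

section Crossed

variable {G A : Type*} [Group G] [NormedRing A] [NormedAlgebra ℂ A] [MulSemiringAction G A]
  {ι : Type*} {E : ι → Type*} [∀ i, NormedAddCommGroup (E i)] [∀ i, NormedSpace ℂ (E i)]
  (ρ : ∀ i, CovariantRep G A (E i)) (hρ : ∀ i, (ρ i).IsContractive)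

/-- The function `G → A` with value `a` at `g` and zero elsewhere, in the seminormed algebra. -/
def SeminormedCore.single (g : G) (a : A) : SeminormedCore ρ hρ := SkewMonoidAlgebra.single g a

lemma SeminormedCore.norm_single_le (g : G) (a : A) : ‖SeminormedCore.single ρ hρ g a‖ ≤ ‖a‖ := by
  rw [SeminormedCore.norm_def]
  -- The nonnegativity argument covers an empty index family, where the supremum is `0`.
  refine Real.iSup_le (fun i => ?_) (norm_nonneg a)
  refine ((congrArg norm ((ρ i).integrated_single g a)).trans_le (norm_mul_le _ _)).trans ?_
  simpa using mul_le_mul ((hρ i).2 a) ((hρ i).1 g) (norm_nonneg _) (norm_nonneg _)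

variable [SMulCommClass G ℂ A]

/-- The image in the crossed product of the function with value `a` at `g` and zero elsewhere. -/
def CrossedProduct.single (g : G) : A →L[ℂ] CrossedProduct ρ hρ :=
  LinearMap.mkContinuous
    { toFun a := ((SeminormedCore.single ρ hρ g a : SeminormedCore ρ hρ) :
        UniformSpace.Completion (SeminormedCore ρ hρ))
      map_add' a b := (congrArg _ (SkewMonoidAlgebra.single_add g a b)).trans
        (UniformSpace.Completion.coe_add _ _)
      map_smul' c a := (congrArg _ (SkewMonoidAlgebra.smul_single c g a).symm).trans
        (UniformSpace.Completion.coe_smul c (SeminormedCore.single ρ hρ g a)) }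
    1 fun a => by
      rw [one_mul]
      exact (UniformSpace.Completion.norm_coe _).trans_le (SeminormedCore.norm_single_le ρ hρ g a)

lemma CrossedProduct.norm_single_le (g : G) (a : A) : ‖CrossedProduct.single ρ hρ g a‖ ≤ ‖a‖ :=
  (UniformSpace.Completion.norm_coe _).trans_le (SeminormedCore.norm_single_le ρ hρ g a)

lemma CrossedProduct.single_mul_single (g h : G) (a b : A) :
    CrossedProduct.single ρ hρ g a * CrossedProduct.single ρ hρ h b =
      CrossedProduct.single ρ hρ (g * h) (a * g • b) :=
  (UniformSpace.Completion.coe_mul (SeminormedCore.single ρ hρ g a)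
    (SeminormedCore.single ρ hρ h b)).symm.trans
    (congrArg _ SkewMonoidAlgebra.single_mul_single)

lemma CrossedProduct.dense_span_single :
    Dense (Submodule.span ℂ {b | ∃ g a, CrossedProduct.single ρ hρ g a = b} :
      Set (CrossedProduct ρ hρ)) := by
  set V : Submodule ℂ (CrossedProduct ρ hρ) :=
    Submodule.span ℂ {b | ∃ g a, CrossedProduct.single ρ hρ g a = b}
  -- `c` is the canonical map with codomain read as `CrossedProduct`, where `V` lives. Its range is
  -- dense, and finitely supported functions are sums of singles.
  let c (f : SeminormedCore ρ hρ) : CrossedProduct ρ hρ :=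
    (f : UniformSpace.Completion (SeminormedCore ρ hρ))
  have hc_add (f f' : SeminormedCore ρ hρ) : c (f + f') = c f + c f' :=
    UniformSpace.Completion.coe_add f f'
  have hc_zero : c 0 = 0 := UniformSpace.Completion.coe_zero
  refine (UniformSpace.Completion.denseRange_coe (α := SeminormedCore ρ hρ)).mono ?_
  rintro _ ⟨f, rfl⟩
  refine SkewMonoidAlgebra.induction_on (p := fun f : SkewMonoidAlgebra A G => c f ∈ V) f
    ?_ (fun g a => Submodule.subset_span ⟨g, a, rfl⟩) fun f f' hf hf' => ?_
  · exact hc_zero.symm ▸ V.zero_mem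
  · exact (hc_add f f').symm ▸ V.add_mem hf hf'

end Crossed

/-- The crossed product by an amenable group of an amenable Banach algebra is amenable, for every
family of contractive covariant representations. -/
theorem CrossedProduct.isAmenableBanachAlgebra {G : Type v} [Group G]
    (hG : IsAmenableGroup G) {A : Type u} [NormedRing A] [NormedAlgebra ℂ A] [CompleteSpace A]
    [MulSemiringAction G A] [SMulCommClass G ℂ A]
    (hA : IsAmenableBanachAlgebra.{u, max v e} A)
    {ι : Type*} {E : ι → Type*} [∀ i, NormedAddCommGroup (E i)] [∀ i, NormedSpace ℂ (E i)]
    (ρ : ∀ i, CovariantRep G A (E i)) (hρ : ∀ i, (ρ i).IsContractive) :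
    IsAmenableBanachAlgebra.{max u v, e} (CrossedProduct ρ hρ) :=
  isAmenableBanachAlgebra_of_skew hG hA (CrossedProduct.single ρ hρ)
    (CrossedProduct.norm_single_le ρ hρ) (CrossedProduct.single_mul_single ρ hρ)
    (CrossedProduct.dense_span_single ρ hρ)

end LpCrossed

end

theorem mainTheorem6 (p : ENNReal) [Fact (1 ≤ p)] [Fact (p ≠ ⊤)]
    (G : Type v) [Group G] [Countable G] [MeasurableSpace G] [DiscreteMeasurableSpace G]
    (hG : LpCrossed.IsAmenableGroup G)
    (A : Type u) [NormedRing A] [NormedAlgebra ℂ A] [CompleteSpace A]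
    (hrep : LpCrossed.IsNondegSigmaFinitelyRepresentable.{u, w} p A)
    [MulSemiringAction G A] [SMulCommClass G ℂ A] [IsIsometricSMul G A]
    (hA : LpCrossed.IsAmenableBanachAlgebra.{u, max v e} A) :
    LpCrossed.IsAmenableBanachAlgebra.{max u v, e} (LpCrossed.FullCrossedProduct.{u, v, w} p G A) ∧
      LpCrossed.IsAmenableBanachAlgebra.{max u v, e}
        (LpCrossed.ReducedCrossedProduct.{u, v, w} p G A) := by
  -- The two conjuncts differ only in the family of representations: all of `FullRep`, or the
  -- regular ones indexed by `SigmaFiniteRep`.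
  exact ⟨LpCrossed.CrossedProduct.isAmenableBanachAlgebra hG hA _ _,
    LpCrossed.CrossedProduct.isAmenableBanachAlgebra hG hA _ _⟩
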